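/- Let $d\in\mathbb N$ and $1<p\le\infty$. Let $b:\mathbb R^d\to\mathbb R^d$ be a Borel vector field, bounded by $B$ (that is, $|b(x)|\le B$ for all $x$), belonging to $W^{1,p}(\mathbb R^d;\mathbb R^d)$ with $\|Db\|_{L^p(\mathbb R^d)}\le D$, with $[\mathrm{div}\,b]^-\in L^\infty(\mathbb R^d)$, and one-sided Lipschitz on every compact set: for every compact $S\subset\mathbb R^d$ there is $\nu_S\in\mathbb R$ with $$\langle b(x)-b(y),x-y\rangle\le\nu_S|x-y|^2\qquad\text{for all }x,y\in S.$$ Let $T>0$ and let $X:[0,T]\times\mathbb R^d\to\mathbb R^d$ be a regular Lagrangian flow of $b$ with compressibility constant $L$: for almost every $x$ the map $t\mapsto X(t,x)$ is absolutely continuous with $X(t,x)=x+\int_0^t b(X(s,x))\,ds$ for $t\in[0,T]$, and $X(t,\cdot)_\#m\le L\,m$ for every $t\in[0,T]$, where $m$ is Lebesgue measure. Let $0<R\le\rho$. There is a $\kappa>0$ that is a one-sided Lipschitz constant of $b$ on the closed ball of radius $\rho+TB$ about $0$. For every such $\kappa$, set $$K=c\,L^{1/p}\,D\,B,\qquad C_{\exp}=\exp\bigl(T(2\kappa+KT)\bigr),$$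 where $c>0$ depends only on $d$ and $p$ (and $L^{1/p}=1$ if $p=\infty$). Then there is a constant $C\ge0$, depending only on $d,p,R,\rho,T,B,\kappa,K$, such that the following holds for every time step $h>0$ and every $n\ge0$ with $t_n=nh\le T$. For every measurable $X_0$ on $B_R(0)$ with $|X_0|\le\rho$ almost everywhere, the explicit Euler iterates $X_{n+1}=X_n+h\,b(X_n)$ satisfy $X(t_n)-X_n\in L^p(B_R(0))$ and $$\|X(t_n)-X_n\|_{L^p(B_R(0))}\le C\sqrt{\frac{C_{\exp}-1}{2\kappa}}\;h^{1/2}+C_{\exp}\,\|X(0)-X_0\|_{L^p(B_R(0))}.$$ In particular, for $X_0(x)=x$, $$\|X(t_n)-X_n\|_{L^p(B_R(0))}\le C\sqrt{\frac{C_{\exp}-1}{2\kappa}}\;h^{1/2},$$ so the scheme converges with order $1/2$, uniformly over the grid times $t_n\in[0,T]$. -/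

import Mathlib

open MeasureTheory Metric Set
open scoped ENNReal NNReal ContDiff

noncomputable section

/-- The Euclidean space `ℝ^d`. -/
abbrev Rd (d : ℕ) : Type := EuclideanSpace ℝ (Fin d)

/-- `Db` is the weak (distributional) derivative of the vector field `b`:
both are locally integrable and `∫ (∂_v φ) b = - ∫ φ (Db v)` for every direction `v` and every
test function `φ ∈ C_c^∞(ℝ^d)`. -/
def HasWeakDeriv {d : ℕ} (b : Rd d → Rd d) (Db : Rd d → Rd d →L[ℝ] Rd d) : Prop :=
  LocallyIntegrable b volume ∧ LocallyIntegrable Db volume ∧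
    ∀ φ : Rd d → ℝ, ContDiff ℝ ∞ φ → HasCompactSupport φ → ∀ v : Rd d,
      ∫ x, (fderiv ℝ φ x v) • b x = - ∫ x, φ x • (Db x v)

/-- `b ∈ W^{1,p}(ℝ^d; ℝ^d)`, with weak derivative `Db`. -/
structure MemW1p {d : ℕ} (p : ℝ≥0∞) (b : Rd d → Rd d) (Db : Rd d → Rd d →L[ℝ] Rd d) : Prop where
  weakDeriv : HasWeakDeriv b Db
  memLp : MemLp b p volume
  memLp_deriv : MemLp Db p volume

/-- The negative part `[div b]^-` of the divergence of a vector field with weak derivative `Db`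
(the divergence is the trace of the weak derivative). -/
def divNegPart {d : ℕ} (Db : Rd d → Rd d →L[ℝ] Rd d) (x : Rd d) : ℝ :=
  max (-(LinearMap.trace ℝ (Rd d) (Db x : Rd d →ₗ[ℝ] Rd d))) 0

/-- The autonomous field `b` satisfies the one-sided Lipschitz condition on `S ⊆ ℝ^d`
with constant `ν`. -/
def OneSidedLipschitzOn {d : ℕ} (b : Rd d → Rd d) (S : Set (Rd d)) (ν : ℝ) : Prop :=
  ∀ x ∈ S, ∀ y ∈ S, inner ℝ (b x - b y) (x - y) ≤ ν * ‖x - y‖ ^ 2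

/-- `X : [0,T] × ℝ^d → ℝ^d` is a regular Lagrangian flow of the autonomous field `b`, with
compressibility constant `L`. An absolutely continuous integral solution `γ` of `γ' = b(γ)`,
`γ(0) = x`, is one for which `b ∘ γ` is integrable and `γ(t) = x + ∫_0^t b(γ(s)) ds`. -/
structure IsRegularLagrangianFlow {d : ℕ} (T : ℝ) (b : Rd d → Rd d) (X : ℝ → Rd d → Rd d)
    (L : ℝ≥0) : Prop where
  aemeasurable : ∀ t ∈ Icc 0 T, AEMeasurable (X t) volume
  integral_solution : ∀ᵐ x ∂(volume : Measure (Rd d)),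
    IntervalIntegrable (fun s => b (X s x)) volume 0 T ∧
      ∀ t ∈ Icc 0 T, X t x = x + ∫ s in (0 : ℝ)..t, b (X s x)
  compress : ∀ t ∈ Icc 0 T, Measure.map (X t) volume ≤ (L : ℝ≥0∞) • (volume : Measure (Rd d))

/-- The explicit Euler iterates `X_{n+1} = X_n + h b(X_n)`, as functions of the space variable,
started from `X₀`. -/
def eulerIter {d : ℕ} (b : Rd d → Rd d) (h : ℝ) (X₀ : Rd d → Rd d) : ℕ → Rd d → Rd d
  | 0 => X₀
  | n + 1 => fun x => eulerIter b h X₀ n x + h • b (eulerIter b h X₀ n x)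

/-- `C_exp = exp (T (2κ + K T))`. -/
def expConst (T κ K : ℝ) : ℝ := Real.exp (T * (2 * κ + K * T))

end

/-!
The estimate holds trajectory by trajectory. Over one Euler step of length `h` the solution moves
by at most `B h`, so the difference of the two velocities can be tested against the initial error
`e` at the cost of a term `2 B² h`: the one-sided Lipschitz condition controls the rest, and `‖e‖²`
grows at most by the factor `1 + 4 κ h` and the increment `4 B² h² (κ h + 2)`. Discrete Grönwall
sums the increments to a squared error of order `h`, so the error is of order `1/2`, with growth
factor `exp (2 κ T) ≤ expConst T κ K`.
-/

section CaratheodorySolution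

variable {E : Type*} [NormedAddCommGroup E] [NormedSpace ℝ E]
  {b : E → E} {B T ρ h : ℝ} {γ : ℝ → E}

/-- A Carathéodory solution of `γ' = b(γ)` on `[0, T]`: an absolutely continuous curve that solves
the equation almost everywhere, encoded through the equivalent integral equation. -/
structure IsCaratheodorySolution (b : E → E) (T : ℝ) (γ : ℝ → E) : Prop where
  intervalIntegrable : IntervalIntegrable (fun s => b (γ s)) volume 0 T
  eq_add_integral : ∀ t ∈ Icc 0 T, γ t = γ 0 + ∫ s in (0 : ℝ)..t, b (γ s)

/-- One step of the explicit Euler scheme with step size `h`; the scheme is its iteration. -/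
def eulerStep (b : E → E) (h : ℝ) (y : E) : E := y + h • b y

namespace IsCaratheodorySolution

lemma intervalIntegrable_of_mem (hγ : IsCaratheodorySolution b T γ) {s t : ℝ} (hs : s ∈ Icc 0 T)
    (ht : t ∈ Icc 0 T) : IntervalIntegrable (fun r => b (γ r)) volume s t := by
  refine hγ.intervalIntegrable.mono_set ?_
  rw [uIcc_of_le (hs.1.trans hs.2)]
  exact uIcc_subset_Icc hs ht

lemma sub_eq_integral (hγ : IsCaratheodorySolution b T γ) {s t : ℝ} (hs : s ∈ Icc 0 T)
    (ht : t ∈ Icc 0 T) : γ t - γ s = ∫ r in s..t, b (γ r) := by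
  have h0 : (0 : ℝ) ∈ Icc 0 T := ⟨le_rfl, hs.1.trans hs.2⟩
  rw [hγ.eq_add_integral t ht, hγ.eq_add_integral s hs, add_sub_add_left_eq_sub,
    intervalIntegral.integral_interval_sub_left (hγ.intervalIntegrable_of_mem h0 ht)
      (hγ.intervalIntegrable_of_mem h0 hs)]

lemma norm_sub_le_mul_abs (hγ : IsCaratheodorySolution b T γ) (hB : ∀ x, ‖b x‖ ≤ B) {s t : ℝ}
    (hs : s ∈ Icc 0 T) (ht : t ∈ Icc 0 T) : ‖γ t - γ s‖ ≤ B * |t - s| := by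
  rw [hγ.sub_eq_integral hs ht]
  exact intervalIntegral.norm_integral_le_of_norm_le_const fun r _ => hB _

lemma mem_closedBall (hγ : IsCaratheodorySolution b T γ) (hB : ∀ x, ‖b x‖ ≤ B) (hρ : ‖γ 0‖ ≤ ρ)
    {t : ℝ} (ht : t ∈ Icc 0 T) : γ t ∈ closedBall 0 (ρ + T * B) := by
  have hB0 : 0 ≤ B := (norm_nonneg _).trans (hB 0)
  rw [mem_closedBall_zero_iff]
  calc ‖γ t‖ ≤ ‖γ 0‖ + ‖γ t - γ 0‖ := norm_le_insert' _ _
    _ ≤ ρ + B * |t - 0| := add_le_add hρ (hγ.norm_sub_le_mul_abs hB ⟨le_rfl, ht.1.trans ht.2⟩ ht)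
    _ ≤ ρ + T * B := by
      rw [sub_zero, abs_of_nonneg ht.1, mul_comm]
      gcongr
      exact ht.2

end IsCaratheodorySolution

lemma norm_iterate_eulerStep_le (hB : ∀ x, ‖b x‖ ≤ B) (hh : 0 ≤ h) (y : E) (n : ℕ) :
    ‖(eulerStep b h)^[n] y‖ ≤ ‖y‖ + n * h * B := by
  induction n with
  | zero => simp
  | succ n ih =>
    rw [Function.iterate_succ_apply']
    set z := (eulerStep b h)^[n] y
    calc ‖z + h • b z‖ ≤ ‖z‖ + ‖h • b z‖ := norm_add_le _ _
      _ ≤ (‖y‖ + n * h * B) + h * B := by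
        rw [norm_smul, Real.norm_of_nonneg hh]
        gcongr
        exact hB z
      _ = ‖y‖ + (n + 1 : ℕ) * h * B := by push_cast; ring

lemma iterate_eulerStep_mem_closedBall (hB : ∀ x, ‖b x‖ ≤ B) (hh : 0 ≤ h) {y : E} (hy : ‖y‖ ≤ ρ)
    {n : ℕ} (hn : n * h ≤ T) : (eulerStep b h)^[n] y ∈ closedBall 0 (ρ + T * B) := by
  have hB0 : 0 ≤ B := (norm_nonneg _).trans (hB 0)
  rw [mem_closedBall_zero_iff]
  exact (norm_iterate_eulerStep_le hB hh y n).trans (by gcongr)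

lemma measurable_iterate_eulerStep [MeasurableSpace E] [BorelSpace E] [SecondCountableTopology E]
    (hb : Measurable b) (h : ℝ) (n : ℕ) : Measurable (eulerStep b h)^[n] :=
  (measurable_id.add (hb.const_smul h)).iterate n

end CaratheodorySolution

section EulerError

variable {E : Type*} [NormedAddCommGroup E] [InnerProductSpace ℝ E]
  {b : E → E} {B T κ ρ h : ℝ} {S : Set E} {γ : ℝ → E}

/-- The one-sided Lipschitz condition on `S` with constant `ν`, in an arbitrary real inner product
space; on `ℝ^d` it is `OneSidedLipschitzOn`. -/
def IsOneSidedLipschitzOn (b : E → E) (S : Set E) (ν : ℝ) : Prop :=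
  ∀ x ∈ S, ∀ y ∈ S, inner ℝ (b x - b y) (x - y) ≤ ν * ‖x - y‖ ^ 2

lemma IsOneSidedLipschitzOn.mono_const {ν : ℝ} (hS : IsOneSidedLipschitzOn b S ν) (hνκ : ν ≤ κ) :
    IsOneSidedLipschitzOn b S κ := fun x hx y hy =>
  (hS x hx y hy).trans (by gcongr)

lemma IsOneSidedLipschitzOn.inner_sub_le (hS : IsOneSidedLipschitzOn b S κ) (hκ : 0 ≤ κ)
    (hB : ∀ x, ‖b x‖ ≤ B) {y z : E} (hy : y ∈ S) (hz : z ∈ S) (x : E) :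
    inner ℝ (x - y) (b z - b y) ≤ κ * (‖x - y‖ + ‖z - x‖) ^ 2 + ‖z - x‖ * (2 * B) := by
  have hsplit : x - y = (z - y) - (z - x) := by abel
  have hdist : ‖z - y‖ ≤ ‖x - y‖ + ‖z - x‖ := by
    rw [add_comm]
    exact norm_sub_le_norm_sub_add_norm_sub z x y
  have hosl : inner ℝ (z - y) (b z - b y) ≤ κ * (‖x - y‖ + ‖z - x‖) ^ 2 := by
    rw [real_inner_comm]
    exact (hS z hz y hy).trans (by gcongr)
  have hcs : -inner ℝ (z - x) (b z - b y) ≤ ‖z - x‖ * (2 * B) :=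
    calc -inner ℝ (z - x) (b z - b y) ≤ ‖z - x‖ * ‖b z - b y‖ :=
          (neg_le_abs _).trans (abs_real_inner_le_norm _ _)
      _ ≤ ‖z - x‖ * (2 * B) := by
        gcongr
        linarith [norm_sub_le (b z) (b y), hB z, hB y]
  calc inner ℝ (x - y) (b z - b y)
      = inner ℝ (z - y) (b z - b y) - inner ℝ (z - x) (b z - b y) := by
        rw [hsplit, inner_sub_left]
    _ ≤ κ * (‖x - y‖ + ‖z - x‖) ^ 2 + ‖z - x‖ * (2 * B) := by linarith

lemma inner_intervalIntegral_le [CompleteSpace E] {f : ℝ → E} {s t M : ℝ} (hst : s ≤ t)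
    (hf : IntervalIntegrable f volume s t) (e : E) (hM : ∀ r ∈ Icc s t, inner ℝ e (f r) ≤ M) :
    inner ℝ e (∫ r in s..t, f r) ≤ (t - s) * M := by
  have hef : IntervalIntegrable (fun r => inner ℝ e (f r)) volume s t :=
    ⟨(innerSL ℝ e).integrable_comp hf.1, (innerSL ℝ e).integrable_comp hf.2⟩
  calc inner ℝ e (∫ r in s..t, f r) = ∫ r in s..t, inner ℝ e (f r) :=
        ((innerSL ℝ e).intervalIntegral_comp_comm hf).symm
    _ ≤ ∫ _ in s..t, M := intervalIntegral.integral_mono_on hst hef intervalIntegrable_const hM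
    _ = (t - s) * M := by rw [intervalIntegral.integral_const, smul_eq_mul]

lemma IsCaratheodorySolution.norm_sub_eulerStep_sq_le [CompleteSpace E]
    (hγ : IsCaratheodorySolution b T γ) (hB : ∀ x, ‖b x‖ ≤ B) (hκ : 0 ≤ κ)
    (hS : IsOneSidedLipschitzOn b S κ) (hγS : ∀ t ∈ Icc 0 T, γ t ∈ S) {y : E} (hy : y ∈ S)
    {t : ℝ} (ht : 0 ≤ t) (hh : 0 ≤ h) (hth : t + h ≤ T) :
    ‖γ (t + h) - eulerStep b h y‖ ^ 2 ≤
      (1 + 4 * κ * h) * ‖γ t - y‖ ^ 2 + 4 * B ^ 2 * h ^ 2 * (κ * h + 2) := by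
  have hB0 : 0 ≤ B := (norm_nonneg _).trans (hB y)
  have hle : t ≤ t + h := le_add_of_nonneg_right hh
  have htT : t ∈ Icc 0 T := ⟨ht, hle.trans hth⟩
  have hthT : t + h ∈ Icc 0 T := ⟨ht.trans hle, hth⟩
  have hint := hγ.intervalIntegrable_of_mem htT hthT
  set e := γ t - y
  set I := ∫ s in t..t + h, (b (γ s) - b y) with hI
  have hdecomp : γ (t + h) - eulerStep b h y = e + I := by
    rw [hI, intervalIntegral.integral_sub hint intervalIntegrable_const,
      intervalIntegral.integral_const, ← hγ.sub_eq_integral htT hthT, add_sub_cancel_left,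
      eulerStep]
    simp only [e]
    abel
  have hnorm : ‖I‖ ≤ 2 * B * h := by
    refine (intervalIntegral.norm_integral_le_of_norm_le_const (C := 2 * B) fun r _ => ?_).trans_eq
      (by rw [add_sub_cancel_left, abs_of_nonneg hh])
    exact (norm_sub_le _ _).trans (by linarith [hB (γ r), hB y])
  have hinner : inner ℝ e I ≤ h * (κ * (‖e‖ + B * h) ^ 2 + B * h * (2 * B)) := by
    refine (inner_intervalIntegral_le hle (hint.sub intervalIntegrable_const) e
      fun s hs => ?_).trans_eq (by rw [add_sub_cancel_left])
    have hsT : s ∈ Icc 0 T := ⟨ht.trans hs.1, hs.2.trans hth⟩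
    have hmove : ‖γ s - γ t‖ ≤ B * h := (hγ.norm_sub_le_mul_abs hB htT hsT).trans (by
      rw [abs_of_nonneg (sub_nonneg.2 hs.1)]
      gcongr
      linarith [hs.2])
    exact (hS.inner_sub_le hκ hB hy (hγS s hsT) (γ t)).trans (by gcongr)
  have hyoung : (‖e‖ + B * h) ^ 2 ≤ 2 * (‖e‖ ^ 2 + (B * h) ^ 2) := add_sq_le
  calc ‖γ (t + h) - eulerStep b h y‖ ^ 2 = ‖e‖ ^ 2 + 2 * inner ℝ e I + ‖I‖ ^ 2 := by
        rw [hdecomp, norm_add_sq_real]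
    _ ≤ ‖e‖ ^ 2 + 2 * (h * (κ * (2 * (‖e‖ ^ 2 + (B * h) ^ 2)) + B * h * (2 * B))) +
        (2 * B * h) ^ 2 := by
      gcongr
      exact hinner.trans (by gcongr)
    _ = (1 + 4 * κ * h) * ‖e‖ ^ 2 + 4 * B ^ 2 * h ^ 2 * (κ * h + 2) := by ring

lemma le_add_mul_exp_of_forall_lt {a : ℕ → ℝ} {c A : ℝ} (ha : ∀ k, 0 ≤ a k) (hc : 0 ≤ c)
    (hA : 0 ≤ A) {n : ℕ} (hstep : ∀ k < n, a (k + 1) ≤ (1 + c) * a k + A) :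
    a n ≤ (a 0 + n * A) * Real.exp (n * c) := by
  -- Stopping the sequence at `n` makes the recursion hold at every index.
  have hstopped : ∀ k ≥ 0, a (min (k + 1) n) ≤ (1 + c) * a (min k n) + A := fun k _ => by
    rcases lt_or_ge k n with hk | hk
    · simpa only [min_eq_left hk.le, min_eq_left (Nat.succ_le_of_lt hk)] using hstep k hk
    · rw [min_eq_right hk, min_eq_right (hk.trans k.le_succ)]
      linarith [mul_nonneg hc (ha n)]
  simpa using discrete_gronwall (u := fun k => a (min k n)) (ha _) hstopped (fun _ _ => hc)
    (fun _ _ => hA) n.zero_le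

lemma IsCaratheodorySolution.norm_sub_iterate_eulerStep_sq_le [CompleteSpace E]
    (hγ : IsCaratheodorySolution b T γ) (hB : ∀ x, ‖b x‖ ≤ B) (hκ : 0 ≤ κ)
    (hS : IsOneSidedLipschitzOn b S κ) (hγS : ∀ t ∈ Icc 0 T, γ t ∈ S) (hh : 0 ≤ h) {y : E} {n : ℕ}
    (hn : n * h ≤ T) (hyS : ∀ k < n, (eulerStep b h)^[k] y ∈ S) :
    ‖γ (n * h) - (eulerStep b h)^[n] y‖ ^ 2 ≤
      (‖γ 0 - y‖ ^ 2 + n * (4 * B ^ 2 * h ^ 2 * (κ * h + 2))) * Real.exp (n * (4 * κ * h)) := by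
  have hgronwall := le_add_mul_exp_of_forall_lt (n := n) (c := 4 * κ * h)
    (a := fun k => ‖γ (k * h) - (eulerStep b h)^[k] y‖ ^ 2)
    (A := 4 * B ^ 2 * h ^ 2 * (κ * h + 2)) (fun k => by positivity) (by positivity)
    (by positivity) fun k hk => by
      have hk_succ : (k + 1 : ℕ) * h = k * h + h := by push_cast; ring
      have hkT : (k : ℝ) * h + h ≤ T := by
        rw [← hk_succ]
        exact le_trans (by gcongr; exact hk) hn
      rw [hk_succ, Function.iterate_succ_apply']
      exact hγ.norm_sub_eulerStep_sq_le hB hκ hS hγS (hyS k hk) (by positivity) hh hkT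
  simpa using hgronwall

lemma IsCaratheodorySolution.norm_sub_iterate_eulerStep_le [CompleteSpace E]
    (hγ : IsCaratheodorySolution b T γ) (hB : ∀ x, ‖b x‖ ≤ B) (hκ : 0 ≤ κ)
    (hS : IsOneSidedLipschitzOn b S κ) (hγS : ∀ t ∈ Icc 0 T, γ t ∈ S) (hh : 0 ≤ h) {y : E} {n : ℕ}
    (hn : n * h ≤ T) (hyS : ∀ k < n, (eulerStep b h)^[k] y ∈ S) :
    ‖γ (n * h) - (eulerStep b h)^[n] y‖ ≤
      Real.exp (2 * κ * T) * (‖γ 0 - y‖ + 2 * B * √(T * (κ * T + 2) * h)) := by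
  have hB0 : 0 ≤ B := (norm_nonneg _).trans (hB y)
  have hT : 0 ≤ T := le_trans (by positivity) hn
  have hexp : Real.exp (n * (4 * κ * h)) ≤ Real.exp (2 * κ * T) ^ 2 := by
    rw [← Real.exp_nat_mul, Real.exp_le_exp]
    calc (n : ℝ) * (4 * κ * h) = 4 * κ * (n * h) := by ring
      _ ≤ 4 * κ * T := by gcongr
      _ = (2 : ℕ) * (2 * κ * T) := by push_cast; ring
  have hsum : n * (4 * B ^ 2 * h ^ 2 * (κ * h + 2)) ≤ (2 * B * √(T * (κ * T + 2) * h)) ^ 2 := by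
    have hsq : (n : ℝ) ≤ (n : ℝ) ^ 2 := by exact_mod_cast Nat.le_self_pow two_ne_zero n
    calc n * (4 * B ^ 2 * h ^ 2 * (κ * h + 2))
        = 4 * B ^ 2 * (κ * (n * h ^ 2) + n * h * 2) * h := by ring
      _ ≤ 4 * B ^ 2 * (κ * (n ^ 2 * h ^ 2) + n * h * 2) * h := by gcongr
      _ = 4 * B ^ 2 * (n * h * (κ * (n * h) + 2)) * h := by ring
      _ ≤ 4 * B ^ 2 * (T * (κ * T + 2)) * h := by gcongr
      _ = (2 * B * √(T * (κ * T + 2) * h)) ^ 2 := by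
        rw [mul_pow, Real.sq_sqrt (by positivity)]
        ring
  refine le_of_sq_le_sq ?_ (by positivity)
  calc ‖γ (n * h) - (eulerStep b h)^[n] y‖ ^ 2
      ≤ (‖γ 0 - y‖ ^ 2 + n * (4 * B ^ 2 * h ^ 2 * (κ * h + 2))) * Real.exp (n * (4 * κ * h)) :=
        hγ.norm_sub_iterate_eulerStep_sq_le hB hκ hS hγS hh hn hyS
    _ ≤ (‖γ 0 - y‖ ^ 2 + (2 * B * √(T * (κ * T + 2) * h)) ^ 2) * Real.exp (2 * κ * T) ^ 2 := by
      gcongr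
    _ ≤ (‖γ 0 - y‖ + 2 * B * √(T * (κ * T + 2) * h)) ^ 2 * Real.exp (2 * κ * T) ^ 2 := by
      gcongr
      rw [add_sq']
      exact le_add_of_nonneg_right (by positivity)
    _ = (Real.exp (2 * κ * T) * (‖γ 0 - y‖ + 2 * B * √(T * (κ * T + 2) * h))) ^ 2 := by ring

end EulerError

section ErrorConst

variable {T κ K : ℝ}

lemma exp_two_mul_le_expConst (hK : 0 ≤ K) : Real.exp (2 * κ * T) ≤ expConst T κ K := by
  refine Real.exp_le_exp.2 ?_
  linarith [mul_nonneg hK (mul_self_nonneg T)]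

lemma le_expConst_sub_one_div (hκ : 0 < κ) (hK : 0 ≤ K) :
    T ≤ (expConst T κ K - 1) / (2 * κ) := by
  rw [le_div_iff₀ (by positivity)]
  linarith [Real.add_one_le_exp (2 * κ * T), exp_two_mul_le_expConst (T := T) (κ := κ) hK]

/-- The constant of `h ^ (1 / 2)` in the `L^p` error estimate on a set of measure `m`, up to the
factor `√((C_exp - 1) / (2 κ))`; the absolute value makes it nonnegative for every `B`. -/
noncomputable def eulerErrorConst (p : ℝ≥0∞) (m T B κ : ℝ) : ℝ :=
  m ^ p.toReal⁻¹ * (Real.exp (2 * κ * T) * (2 * |B| * √(κ * T + 2)))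

lemma eulerErrorConst_nonneg (p : ℝ≥0∞) {m : ℝ} (hm : 0 ≤ m) (T B κ : ℝ) :
    0 ≤ eulerErrorConst p m T B κ := by
  unfold eulerErrorConst
  positivity

lemma rpow_mul_le_eulerErrorConst_mul (p : ℝ≥0∞) {m B h : ℝ} (hm : 0 ≤ m) (hT : 0 ≤ T)
    (hB : 0 ≤ B) (hκ : 0 < κ) (hK : 0 ≤ K) :
    m ^ p.toReal⁻¹ * (Real.exp (2 * κ * T) * (2 * B * √(T * (κ * T + 2) * h))) ≤
      eulerErrorConst p m T B κ * √((expConst T κ K - 1) / (2 * κ)) * h ^ (1 / 2 : ℝ) := by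
  have hsqrt : √(T * (κ * T + 2) * h) = √(κ * T + 2) * √T * √h := by
    rw [Real.sqrt_mul (by positivity), Real.sqrt_mul hT, mul_comm √T]
  calc m ^ p.toReal⁻¹ * (Real.exp (2 * κ * T) * (2 * B * √(T * (κ * T + 2) * h)))
      = eulerErrorConst p m T B κ * √T * √h := by
        rw [hsqrt, eulerErrorConst, abs_of_nonneg hB]
        ring
    _ ≤ eulerErrorConst p m T B κ * √((expConst T κ K - 1) / (2 * κ)) * √h := by
        have := eulerErrorConst_nonneg p hm T B κ
        gcongr
        exact le_expConst_sub_one_div hκ hK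
    _ = _ := by rw [Real.sqrt_eq_rpow h]

end ErrorConst

section LpError

variable {α : Type*} [MeasurableSpace α] {μ : Measure α} {p : ℝ≥0∞}

lemma eLpNorm_le_of_ae_norm_le_mul_add {F G : Type*} [NormedAddCommGroup F] [NormedAddCommGroup G]
    (hp : 1 ≤ p) {f : α → F} {g : α → G} (hg : AEStronglyMeasurable g μ) {a m : ℝ} (ha : 0 ≤ a)
    (hm : 0 ≤ m) (hfg : ∀ᵐ x ∂μ, ‖f x‖ ≤ a * ‖g x‖ + m) :
    eLpNorm f p μ ≤
      ENNReal.ofReal a * eLpNorm g p μ + μ univ ^ p.toReal⁻¹ * ENNReal.ofReal m := by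
  have hlinear : eLpNorm (fun x => a * ‖g x‖) p μ = ENNReal.ofReal a * eLpNorm g p μ := by
    rw [← eLpNorm_norm g, ← Real.enorm_of_nonneg ha]
    exact eLpNorm_const_smul a (fun x => ‖g x‖) p μ
  calc eLpNorm f p μ ≤ eLpNorm ((fun x => a * ‖g x‖) + fun _ => m) p μ :=
        eLpNorm_mono_ae_real hfg
    _ ≤ eLpNorm (fun x => a * ‖g x‖) p μ + eLpNorm (fun _ => m) p μ :=
        eLpNorm_add_le (hg.norm.const_mul a) aestronglyMeasurable_const hp
    _ ≤ ENNReal.ofReal a * eLpNorm g p μ + μ univ ^ p.toReal⁻¹ * ENNReal.ofReal m := by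
        rw [hlinear]
        gcongr
        exact eLpNorm_le_of_ae_bound (.of_forall fun _ => (Real.norm_of_nonneg hm).le)

variable {E : Type*} [NormedAddCommGroup E] {b : E → E} {B T κ ρ h : ℝ} {n : ℕ}
  {X : ℝ → α → E} {Y : α → E}

lemma memLp_sub_iterate_eulerStep [NormedSpace ℝ E] [MeasurableSpace E] [BorelSpace E]
    [SecondCountableTopology E] [IsFiniteMeasure μ] (hb : Measurable b) (hB : ∀ x, ‖b x‖ ≤ B)
    (hsol : ∀ᵐ x ∂μ, IsCaratheodorySolution b T fun t => X t x)
    (hX₀ : ∀ᵐ x ∂μ, ‖X 0 x‖ ≤ ρ) (hY : AEMeasurable Y μ) (hYρ : ∀ᵐ x ∂μ, ‖Y x‖ ≤ ρ) (hh : 0 ≤ h)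
    (hn : n * h ≤ T) (hX : AEMeasurable (X (n * h)) μ) :
    MemLp (fun x => X (n * h) x - (eulerStep b h)^[n] (Y x)) p μ := by
  have hmeas := hX.sub ((measurable_iterate_eulerStep hb h n).comp_aemeasurable hY)
  refine .of_bound hmeas.aestronglyMeasurable ((ρ + T * B) + (ρ + T * B)) ?_
  filter_upwards [hsol, hX₀, hYρ] with x hx hx₀ hy
  have hX_mem := hx.mem_closedBall hB hx₀ ⟨by positivity, hn⟩
  have hY_mem := iterate_eulerStep_mem_closedBall hB hh hy hn
  exact norm_sub_le_of_le (mem_closedBall_zero_iff.1 hX_mem) (mem_closedBall_zero_iff.1 hY_mem)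

lemma eLpNorm_sub_iterate_eulerStep_le [InnerProductSpace ℝ E] [CompleteSpace E] (hp : 1 ≤ p)
    (hB : ∀ x, ‖b x‖ ≤ B) (hκ : 0 ≤ κ)
    (hS : IsOneSidedLipschitzOn b (closedBall 0 (ρ + T * B)) κ)
    (hsol : ∀ᵐ x ∂μ, IsCaratheodorySolution b T fun t => X t x)
    (hX₀ : ∀ᵐ x ∂μ, ‖X 0 x‖ ≤ ρ) (hYρ : ∀ᵐ x ∂μ, ‖Y x‖ ≤ ρ)
    (hXY : AEStronglyMeasurable (fun x => X 0 x - Y x) μ) (hh : 0 ≤ h) (hn : n * h ≤ T) :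
    eLpNorm (fun x => X (n * h) x - (eulerStep b h)^[n] (Y x)) p μ ≤
      ENNReal.ofReal (Real.exp (2 * κ * T)) * eLpNorm (fun x => X 0 x - Y x) p μ +
        μ univ ^ p.toReal⁻¹ *
          ENNReal.ofReal (Real.exp (2 * κ * T) * (2 * B * √(T * (κ * T + 2) * h))) := by
  have hB0 : 0 ≤ B := (norm_nonneg _).trans (hB 0)
  refine eLpNorm_le_of_ae_norm_le_mul_add hp hXY (by positivity) (by positivity) ?_
  filter_upwards [hsol, hX₀, hYρ] with x hx hx₀ hy
  rw [← mul_add]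
  refine hx.norm_sub_iterate_eulerStep_le hB hκ hS (fun t => hx.mem_closedBall hB hx₀) hh hn
    fun k hk => iterate_eulerStep_mem_closedBall hB hh hy (le_trans ?_ hn)
  gcongr

lemma eLpNorm_sub_iterate_eulerStep_le_eulerErrorConst [InnerProductSpace ℝ E] [CompleteSpace E]
    [IsFiniteMeasure μ] (hp : 1 ≤ p) (hB : ∀ x, ‖b x‖ ≤ B) (hκ : 0 < κ)
    (hS : IsOneSidedLipschitzOn b (closedBall 0 (ρ + T * B)) κ)
    (hsol : ∀ᵐ x ∂μ, IsCaratheodorySolution b T fun t => X t x)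
    (hX₀ : ∀ᵐ x ∂μ, ‖X 0 x‖ ≤ ρ) (hYρ : ∀ᵐ x ∂μ, ‖Y x‖ ≤ ρ)
    (hXY : AEStronglyMeasurable (fun x => X 0 x - Y x) μ) (hh : 0 ≤ h) (hn : n * h ≤ T)
    {K : ℝ} (hK : 0 ≤ K) :
    eLpNorm (fun x => X (n * h) x - (eulerStep b h)^[n] (Y x)) p μ ≤
      ENNReal.ofReal (eulerErrorConst p (μ.real univ) T B κ *
        √((expConst T κ K - 1) / (2 * κ)) * h ^ (1 / 2 : ℝ)) +
      ENNReal.ofReal (expConst T κ K) * eLpNorm (fun x => X 0 x - Y x) p μ := by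
  have hT : 0 ≤ T := le_trans (by positivity) hn
  have hB0 : 0 ≤ B := (norm_nonneg _).trans (hB 0)
  have hconst : μ univ ^ p.toReal⁻¹ *
      ENNReal.ofReal (Real.exp (2 * κ * T) * (2 * B * √(T * (κ * T + 2) * h))) ≤
      ENNReal.ofReal (eulerErrorConst p (μ.real univ) T B κ *
        √((expConst T κ K - 1) / (2 * κ)) * h ^ (1 / 2 : ℝ)) := by
    rw [← ofReal_measureReal (measure_ne_top μ univ),
      ENNReal.ofReal_rpow_of_nonneg measureReal_nonneg (by positivity),
      ← ENNReal.ofReal_mul (by positivity)]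
    exact ENNReal.ofReal_le_ofReal
      (rpow_mul_le_eulerErrorConst_mul p measureReal_nonneg hT hB0 hκ hK)
  refine (eLpNorm_sub_iterate_eulerStep_le hp hB hκ.le hS hsol hX₀ hYρ hXY hh hn).trans ?_
  rw [add_comm]
  gcongr
  exact exp_two_mul_le_expConst hK

end LpError

lemma exists_pos_isOneSidedLipschitzOn_closedBall {E : Type*} [NormedAddCommGroup E]
    [InnerProductSpace ℝ E] [ProperSpace E] {b : E → E}
    (hb : ∀ S : Set E, IsCompact S → ∃ ν : ℝ, IsOneSidedLipschitzOn b S ν) (x : E) (r : ℝ) :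
    ∃ κ : ℝ, 0 < κ ∧ IsOneSidedLipschitzOn b (closedBall x r) κ := by
  obtain ⟨ν, hν⟩ := hb _ (isCompact_closedBall x r)
  exact ⟨max ν 1, by positivity, hν.mono_const (le_max_left _ _)⟩

theorem theorem3p1_general {E : Type*} [NormedAddCommGroup E] [InnerProductSpace ℝ E]
    [ProperSpace E] [MeasurableSpace E] [BorelSpace E] (μ : Measure E)
    [IsFiniteMeasureOnCompacts μ] (p : ℝ≥0∞) (hp : 1 ≤ p) :
    ∃ C : ℝ → ℝ → ℝ → ℝ → ℝ, (∀ R T B κ : ℝ, 0 ≤ C R T B κ) ∧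
      ∀ (b : E → E) (B : ℝ), Measurable b → (∀ x, ‖b x‖ ≤ B) →
        (∀ S : Set E, IsCompact S → ∃ ν : ℝ, IsOneSidedLipschitzOn b S ν) →
      ∀ (R ρ T : ℝ) (X : ℝ → E → E), R ≤ ρ →
        (∀ t ∈ Icc 0 T, AEMeasurable (X t) (μ.restrict (ball 0 R))) →
        (∀ᵐ x ∂(μ.restrict (ball 0 R)), X 0 x = x ∧ IsCaratheodorySolution b T fun t => X t x) →
        (∃ κ : ℝ, 0 < κ ∧ IsOneSidedLipschitzOn b (closedBall 0 (ρ + T * B)) κ) ∧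
        ∀ κ K : ℝ, 0 < κ → IsOneSidedLipschitzOn b (closedBall 0 (ρ + T * B)) κ → 0 ≤ K →
        ∀ (h : ℝ) (n : ℕ), 0 ≤ h → (n : ℝ) * h ≤ T →
          (∀ X₀ : E → E, AEMeasurable X₀ (μ.restrict (ball 0 R)) →
            (∀ᵐ x ∂(μ.restrict (ball 0 R)), ‖X₀ x‖ ≤ ρ) →
            MemLp (fun x => X (n * h) x - (eulerStep b h)^[n] (X₀ x)) p (μ.restrict (ball 0 R)) ∧
            eLpNorm (fun x => X (n * h) x - (eulerStep b h)^[n] (X₀ x)) p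
                (μ.restrict (ball 0 R)) ≤
              ENNReal.ofReal (C R T B κ * √((expConst T κ K - 1) / (2 * κ)) * h ^ (1 / 2 : ℝ)) +
              ENNReal.ofReal (expConst T κ K) *
                eLpNorm (fun x => X 0 x - X₀ x) p (μ.restrict (ball 0 R))) ∧
          eLpNorm (fun x => X (n * h) x - (eulerStep b h)^[n] x) p (μ.restrict (ball 0 R)) ≤
            ENNReal.ofReal
              (C R T B κ * √((expConst T κ K - 1) / (2 * κ)) * h ^ (1 / 2 : ℝ)) := by
  refine ⟨fun R => eulerErrorConst p (μ.real (ball 0 R)),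
    fun R => eulerErrorConst_nonneg p measureReal_nonneg, ?_⟩
  intro b B hb hB hosl R ρ T X hRρ hX hsol
  refine ⟨exists_pos_isOneSidedLipschitzOn_closedBall hosl 0 _, ?_⟩
  intro κ K hκ hS hK h n hh hn
  have hT : 0 ≤ T := le_trans (by positivity) hn
  have hfin : IsFiniteMeasure (μ.restrict (ball 0 R)) :=
    isFiniteMeasure_restrict.2 measure_ball_lt_top.ne
  have hid : ∀ᵐ x ∂(μ.restrict (ball (0 : E) R)), ‖x‖ ≤ ρ := by
    filter_upwards [ae_restrict_mem measurableSet_ball] with x hx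
    exact (mem_ball_zero_iff.1 hx).le.trans hRρ
  have hX₀ : X 0 =ᵐ[μ.restrict (ball 0 R)] fun x => x := hsol.mono fun x hx => hx.1
  have hX₀ρ : ∀ᵐ x ∂(μ.restrict (ball (0 : E) R)), ‖X 0 x‖ ≤ ρ := by
    filter_upwards [hX₀, hid] with x hx hxρ
    rwa [hx]
  have herror {Y : E → E} (hY : AEMeasurable Y (μ.restrict (ball 0 R)))
      (hYρ : ∀ᵐ x ∂(μ.restrict (ball 0 R)), ‖Y x‖ ≤ ρ) :=
    eLpNorm_sub_iterate_eulerStep_le_eulerErrorConst hp hB hκ hS (hsol.mono fun x hx => hx.2)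
      hX₀ρ hYρ ((hX 0 ⟨le_rfl, hT⟩).sub hY).aestronglyMeasurable hh hn hK
  simp only [measureReal_restrict_apply_univ] at herror
  refine ⟨fun Y hY hYρ => ⟨?_, herror hY hYρ⟩, (herror aemeasurable_id hid).trans_eq ?_⟩
  · exact memLp_sub_iterate_eulerStep hb hB (hsol.mono fun x hx => hx.2) hX₀ρ hY hYρ hh hn
      (hX _ ⟨by positivity, hn⟩)
  · have hzero : (fun x => X 0 x - id x) =ᵐ[μ.restrict (ball 0 R)] 0 := by
      filter_upwards [hX₀] with x hx using sub_eq_zero.2 hx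
    rw [eLpNorm_congr_ae hzero, eLpNorm_zero, mul_zero, add_zero]

section RegularLagrangianFlow

variable {d : ℕ} {b : Rd d → Rd d}

lemma eulerIter_eq_iterate (h : ℝ) (X₀ : Rd d → Rd d) (n : ℕ) (x : Rd d) :
    eulerIter b h X₀ n x = (eulerStep b h)^[n] (X₀ x) := by
  induction n with
  | zero => rfl
  | succ n ih => rw [Function.iterate_succ_apply', ← ih, eulerIter, eulerStep]

lemma IsRegularLagrangianFlow.ae_isCaratheodorySolution {T : ℝ} {X : ℝ → Rd d → Rd d} {L : ℝ≥0}
    (hX : IsRegularLagrangianFlow T b X L) (hT : 0 ≤ T) :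
    ∀ᵐ x, X 0 x = x ∧ IsCaratheodorySolution b T fun t => X t x := by
  filter_upwards [hX.integral_solution] with x ⟨hint, hsol⟩
  have hx : X 0 x = x := by simpa using hsol 0 ⟨le_rfl, hT⟩
  exact ⟨hx, hint, fun t ht => by rw [hx, hsol t ht]⟩

end RegularLagrangianFlow

/-- The constant `c` depends only on `d` and `p`, and `C` only on `d, p, R, ρ, T, B, κ, K`, where
`B` bounds `|b|`, `L` is the compressibility constant of the flow, `D` bounds `‖Db‖_{L^p}`,
`K = c L^{1/p} D B`, and `κ` is any positive one-sided Lipschitz constant of `b` on the ball of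
radius `ρ + T B`, which contains all the trajectories and iterates; that there is one is the first
part of the conclusion. In `(1 / p).toReal` the case `p = ∞` gives the exponent `0`. -/
theorem theorem3p1 (d : ℕ) (p : ℝ≥0∞) (hp : 1 < p) :
    ∃ (c : ℝ) (C : ℝ → ℝ → ℝ → ℝ → ℝ → ℝ → ℝ),
      0 < c ∧ (∀ R ρ T B κ K : ℝ, 0 ≤ C R ρ T B κ K) ∧
      ∀ (b : Rd d → Rd d) (Db : Rd d → Rd d →L[ℝ] Rd d) (B : ℝ) (D : ℝ≥0),
        Measurable b → (∀ x, ‖b x‖ ≤ B) → MemW1p p b Db → eLpNorm Db p volume ≤ (D : ℝ≥0∞) →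
        (∀ S : Set (Rd d), IsCompact S → ∃ ν : ℝ, OneSidedLipschitzOn b S ν) →
        MemLp (divNegPart Db) ∞ volume →
      ∀ (T : ℝ) (X : ℝ → Rd d → Rd d) (L : ℝ≥0),
        0 < T → IsRegularLagrangianFlow T b X L →
      ∀ R ρ : ℝ, 0 < R → R ≤ ρ →
        (∃ κ : ℝ, 0 < κ ∧ OneSidedLipschitzOn b (closedBall 0 (ρ + T * B)) κ) ∧
        ∀ κ K : ℝ, 0 < κ → OneSidedLipschitzOn b (closedBall 0 (ρ + T * B)) κ →
          K = c * (L : ℝ) ^ (1 / p).toReal * (D : ℝ) * B →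
        ∀ (h : ℝ) (n : ℕ), 0 < h → (n : ℝ) * h ≤ T →
          (∀ X₀ : Rd d → Rd d, AEMeasurable X₀ (volume.restrict (ball 0 R)) →
            (∀ᵐ x ∂(volume.restrict (ball (0 : Rd d) R)), ‖X₀ x‖ ≤ ρ) →
            MemLp (fun x => X (n * h) x - eulerIter b h X₀ n x) p (volume.restrict (ball 0 R)) ∧
            eLpNorm (fun x => X (n * h) x - eulerIter b h X₀ n x) p (volume.restrict (ball 0 R)) ≤
              ENNReal.ofReal
                (C R ρ T B κ K * √((expConst T κ K - 1) / (2 * κ)) * h ^ (1 / 2 : ℝ)) +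
              ENNReal.ofReal (expConst T κ K) *
                eLpNorm (fun x => X 0 x - X₀ x) p (volume.restrict (ball 0 R))) ∧
          eLpNorm (fun x => X (n * h) x - eulerIter b h (fun y => y) n x) p
              (volume.restrict (ball 0 R)) ≤
            ENNReal.ofReal
              (C R ρ T B κ K * √((expConst T κ K - 1) / (2 * κ)) * h ^ (1 / 2 : ℝ)) := by
  obtain ⟨C, hC, hmain⟩ := theorem3p1_general (volume : Measure (Rd d)) p hp.le
  refine ⟨1, fun R _ T B κ _ => C R T B κ, one_pos, fun R _ T B κ _ => hC R T B κ, ?_⟩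
  intro b Db B D hb hB _ _ hosl _ T X L hT hX R ρ _ hRρ
  have hB0 : 0 ≤ B := (norm_nonneg _).trans (hB 0)
  obtain ⟨hκ, herror⟩ := hmain b B hb hB hosl R ρ T X hRρ
    (fun t ht => (hX.aemeasurable t ht).restrict)
    (ae_restrict_of_ae (hX.ae_isCaratheodorySolution hT.le))
  simp only [eulerIter_eq_iterate]
  exact ⟨hκ, fun κ K hκ hS hK h n hh => herror κ K hκ hS (hK ▸ by positivity) h n hh.le⟩
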